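/- Let $L^{(0)}=\partial+\partial^{-1}+\partial^{-3}+\partial^{-5}+\cdots$ (with $\partial=\partial_x$) be the seed Lax operator of the CKP hierarchy, and write $x=t_1$, $y=t_3$, $t=t_5$. For $m=1,2$ let $n_m\ge 1$ and $$\phi_m(x,y,t)=\sum_{i=1}^{n_m}k_{m,i}\,e^{a_{m,i}x+\alpha_{m,i}y+\beta_{m,i}t},\qquad k_{m,i}>0,$$ where all parameters are real, $\alpha_{m,i},\beta_{m,i}$ satisfy $$\alpha^5-25\alpha^3+30\beta\alpha^2+1215\alpha-\beta^3-243\beta=0,\qquad \alpha^2+\alpha\beta+81\neq 0,$$ and $$a_{m,i}=\frac{\alpha_{m,i}^3-18\alpha_{m,i}+9\beta_{m,i}}{\alpha_{m,i}^2+\alpha_{m,i}\beta_{m,i}+81}.$$ Assume that $a_{1,i}<a_{2,j}$ for all $i,j$, and that all the exponents $a_{1,i},a_{2,j}$ have the same sign (all are positive, or all are negative). Then the following hold. (1) $\phi_1,\phi_2$ are eigenfunctions of the seed: $\phi_{m,y}=B_3\phi_m$ and $\phi_{m,t}=B_5\phi_m$ with $B_n=\big((L^{(0)})^n\big)_+$,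 i.e. $B_3=\partial^3+3\partial$, $B_5=\partial^5+5\partial^3+15\partial$. (2) Let $\int$ denote the $x$-primitive, without constant of integration, of a sum of exponentials (the primitive of $e^{cx}$ being $e^{cx}/c$). Then, for all $(x,y,t)\in\mathbb R^3$, $$\mathrm{IW}_{2,2}=\begin{vmatrix}\int\phi_1\phi_2&\int\phi_2^2\\ \int\phi_1^2&\int\phi_1\phi_2\end{vmatrix}<0 .$$ (3) The function $u=u_2^{(2+2)}=1+(\log|\mathrm{IW}_{2,2}|)_{xx}$ is smooth on all of $\mathbb R^3$ and solves the (2+1)-dimensional Kaup–Kuperschmidt equation $$u_t=\tfrac59\Big(\partial_x^{-1}u_{yy}+3u_x\,\partial_x^{-1}u_y-\tfrac15u_{xxxxx}-3uu_{xxx}-\tfrac{15}{2}u_xu_{xx}-9u^2u_x+u_{xxy}+3uu_y\Big),$$ where the primitive $\partial_x^{-1}u_y$ is $w=6+(\log|\mathrm{IW}_{2,2}|)_{xy}$ (so $w_x=u_y$) and $\partial_x^{-1}u_{yy}=w_y$. -/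

import Mathlib

open Set MeasureTheory
open scoped ContDiff

noncomputable section

namespace CKP

/-- Real functions of the three variables `x = t₁`, `y = t₃`, `t = t₅`. -/
abbrev Field : Type := ℝ → ℝ → ℝ → ℝ

/-- Partial derivative in `x`. -/
def dx (f : Field) : Field := fun x y t => deriv (fun s => f s y t) x

/-- Partial derivative in `y`. -/
def dy (f : Field) : Field := fun x y t => deriv (fun s => f x s t) y

/-- Partial derivative in `t`. -/
def dt (f : Field) : Field := fun x y t => deriv (fun s => f x y s) t

/-- `f` is smooth (hence free of singularities) on all of `ℝ³`. -/
def Smooth (f : Field) : Prop :=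
  ContDiff ℝ ∞ (fun p : ℝ × ℝ × ℝ => f p.1 p.2.1 p.2.2)

/-! ### The seed and its eigenfunctions -/

/-- The power series `1 + X² + X⁴ + ⋯`. With `X = ∂⁻¹`, the seed Lax operator
`L = ∂ + ∂⁻¹ + ∂⁻³ + ∂⁻⁵ + ⋯` equals `∂ · (1 + X² + X⁴ + ⋯)`. -/
def seedSeries : PowerSeries ℝ := PowerSeries.mk fun j => if Even j then 1 else 0

/-- The differential part `B_n = (Lⁿ)₊` of the `n`-th power of the seed operator, acting on
functions. As `L` has constant coefficients, `Lⁿ = ∂ⁿ · (1 + X² + X⁴ + ⋯)ⁿ` with `X = ∂⁻¹`, and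
the coefficient of `∂ᵏ` is the coefficient of `X^(n-k)` in the `n`-th power of the series. -/
def seedB (n : ℕ) (f : Field) : Field := fun x y t =>
  ∑ k ∈ Finset.range (n + 1), PowerSeries.coeff (n - k) (seedSeries ^ n) * (dx^[k] f) x y t

/-- Eigenfunctions of the seed: `φ_{t₃} = B₃ φ` and `φ_{t₅} = B₅ φ`. -/
def IsSeedEigenfunction (φ : Field) : Prop :=
  Smooth φ ∧ dy φ = seedB 3 φ ∧ dt φ = seedB 5 φ

/-! ### Sums of exponentials -/

/-- The parameters `k_j`, `α_j`, `β_j` of the function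
`∑ j, k_j * exp (a_j x + α_j y + β_j t)`, where `a_j` is determined by `α_j`, `β_j`
(see `ExpSum.a`). -/
structure ExpSum where
  /-- the number of exponentials -/
  n : ℕ
  /-- the coefficients -/
  k : Fin n → ℝ
  /-- the `y`-exponents -/
  α : Fin n → ℝ
  /-- the `t`-exponents -/
  β : Fin n → ℝ

namespace ExpSum

/-- The `x`-exponent `a_j`. -/
def a (φ : ExpSum) (j : Fin φ.n) : ℝ :=
  (φ.α j ^ 3 - 18 * φ.α j + 9 * φ.β j) / (φ.α j ^ 2 + φ.α j * φ.β j + 81)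

/-- The relation between `α_j` and `β_j`, for every `j`. -/
def Relation (φ : ExpSum) : Prop :=
  ∀ j, φ.α j ^ 5 - 25 * φ.α j ^ 3 + 30 * φ.β j * φ.α j ^ 2 + 1215 * φ.α j
    - φ.β j ^ 3 - 243 * φ.β j = 0

/-- The function `∑ j, k_j * exp (a_j x + α_j y + β_j t)`. -/
def eval (φ : ExpSum) : Field := fun x y t =>
  ∑ j, φ.k j * Real.exp (φ.a j * x + φ.α j * y + φ.β j * t)

/-- `∫ φ ψ`: the `x`-primitive, without constant of integration, of the sum of exponentials
`φ ψ`. It is taken term by term, `e^{cx}` having the primitive `e^{cx} / c`. -/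
def intMul (φ ψ : ExpSum) : Field := fun x y t =>
  ∑ i, ∑ j, φ.k i * ψ.k j *
    Real.exp ((φ.a i + ψ.a j) * x + (φ.α i + ψ.α j) * y + (φ.β i + ψ.β j) * t)
      / (φ.a i + ψ.a j)

theorem eval_mul_eval (φ ψ : ExpSum) (x y t : ℝ) :
    φ.eval x y t * ψ.eval x y t =
      ∑ i, ∑ j, φ.k i * ψ.k j *
        Real.exp ((φ.a i + ψ.a j) * x + (φ.α i + ψ.α j) * y + (φ.β i + ψ.β j) * t) := by
  simp only [eval, Finset.sum_mul_sum]
  refine Finset.sum_congr rfl fun i _ => Finset.sum_congr rfl fun j _ => ?_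
  rw [mul_mul_mul_comm, ← Real.exp_add]
  congr 2
  ring

/-- `intMul φ ψ` is a primitive of `φ ψ` with respect to `x`. -/
theorem hasDerivAt_intMul (φ ψ : ExpSum) (h : ∀ i j, φ.a i + ψ.a j ≠ 0) (x y t : ℝ) :
    HasDerivAt (fun s => φ.intMul ψ s y t) (φ.eval x y t * ψ.eval x y t) x := by
  rw [eval_mul_eval]
  refine HasDerivAt.fun_sum fun i _ => HasDerivAt.fun_sum fun j _ => ?_
  have h1 : HasDerivAt (fun s : ℝ =>
      (φ.a i + ψ.a j) * s + (φ.α i + ψ.α j) * y + (φ.β i + ψ.β j) * t) (φ.a i + ψ.a j) x := by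
    simpa using
      (((hasDerivAt_id x).const_mul (φ.a i + ψ.a j)).add_const
        ((φ.α i + ψ.α j) * y)).add_const ((φ.β i + ψ.β j) * t)
  have h2 := (h1.exp.const_mul (φ.k i * ψ.k j)).div_const (φ.a i + ψ.a j)
  rwa [← mul_assoc, mul_div_assoc, div_self (h i j), mul_one] at h2

/-- If all `x`-exponents are positive, `intMul φ ψ` is the integral of `φ ψ` from `-∞` to `x`. -/
theorem intMul_eq_integral_Iic (φ ψ : ExpSum) (hφ : ∀ i, 0 < φ.a i) (hψ : ∀ j, 0 < ψ.a j)
    (x y t : ℝ) :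
    φ.intMul ψ x y t = ∫ s in Iic x, φ.eval s y t * ψ.eval s y t := by
  have e : ∀ (i : Fin φ.n) (j : Fin ψ.n) (s : ℝ), φ.k i * ψ.k j *
      Real.exp ((φ.a i + ψ.a j) * s + (φ.α i + ψ.α j) * y + (φ.β i + ψ.β j) * t) =
      (φ.k i * ψ.k j * Real.exp ((φ.α i + ψ.α j) * y + (φ.β i + ψ.β j) * t)) *
        Real.exp ((φ.a i + ψ.a j) * s) := by
    intro i j s
    rw [mul_assoc (φ.k i * ψ.k j), ← Real.exp_add]
    congr 2
    ring
  have hp : ∀ i j, 0 < φ.a i + ψ.a j := fun i j => add_pos (hφ i) (hψ j)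
  have hi : ∀ i j, IntegrableOn (fun s : ℝ =>
      (φ.k i * ψ.k j * Real.exp ((φ.α i + ψ.α j) * y + (φ.β i + ψ.β j) * t)) *
        Real.exp ((φ.a i + ψ.a j) * s)) (Iic x) := fun i j =>
    (integrableOn_exp_mul_Iic (hp i j) x).const_mul _
  simp only [eval_mul_eval, intMul, e]
  rw [integral_finsetSum _ fun i _ => integrable_finsetSum _ fun j _ => hi i j]
  refine Finset.sum_congr rfl fun i _ => ?_
  rw [integral_finsetSum _ fun j _ => hi i j]
  refine Finset.sum_congr rfl fun j _ => ?_
  rw [integral_const_mul, integral_exp_mul_Iic (hp i j), mul_div_assoc]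

/-- If all `x`-exponents are negative, `intMul φ ψ` is minus the integral of `φ ψ` from `x` to
`∞`. -/
theorem intMul_eq_neg_integral_Ioi (φ ψ : ExpSum) (hφ : ∀ i, φ.a i < 0) (hψ : ∀ j, ψ.a j < 0)
    (x y t : ℝ) :
    φ.intMul ψ x y t = -∫ s in Ioi x, φ.eval s y t * ψ.eval s y t := by
  have e : ∀ (i : Fin φ.n) (j : Fin ψ.n) (s : ℝ), φ.k i * ψ.k j *
      Real.exp ((φ.a i + ψ.a j) * s + (φ.α i + ψ.α j) * y + (φ.β i + ψ.β j) * t) =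
      (φ.k i * ψ.k j * Real.exp ((φ.α i + ψ.α j) * y + (φ.β i + ψ.β j) * t)) *
        Real.exp ((φ.a i + ψ.a j) * s) := by
    intro i j s
    rw [mul_assoc (φ.k i * ψ.k j), ← Real.exp_add]
    congr 2
    ring
  have hp : ∀ i j, φ.a i + ψ.a j < 0 := fun i j => add_neg (hφ i) (hψ j)
  have hi : ∀ i j, IntegrableOn (fun s : ℝ =>
      (φ.k i * ψ.k j * Real.exp ((φ.α i + ψ.α j) * y + (φ.β i + ψ.β j) * t)) *
        Real.exp ((φ.a i + ψ.a j) * s)) (Ioi x) := fun i j =>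
    (integrableOn_exp_mul_Ioi (hp i j) x).const_mul _
  simp only [eval_mul_eval, intMul, e]
  rw [integral_finsetSum _ fun i _ => integrable_finsetSum _ fun j _ => hi i j]
  rw [← Finset.sum_neg_distrib]
  refine Finset.sum_congr rfl fun i _ => ?_
  rw [integral_finsetSum _ fun j _ => hi i j]
  rw [← Finset.sum_neg_distrib]
  refine Finset.sum_congr rfl fun j _ => ?_
  rw [integral_const_mul, integral_exp_mul_Ioi (hp i j), mul_div_assoc]
  ring

end ExpSum

/-- The determinant
`IW_{2,2}(ψ₂, ψ₁; φ₁, φ₂) = | ∫φ₁ψ₂  ∫φ₂ψ₂ ; ∫φ₁ψ₁  ∫φ₂ψ₁ |`. -/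
def IW22 (ψ₂ ψ₁ φ₁ φ₂ : ExpSum) : Field := fun x y t =>
  Matrix.det !![φ₁.intMul ψ₂ x y t, φ₂.intMul ψ₂ x y t;
                φ₁.intMul ψ₁ x y t, φ₂.intMul ψ₁ x y t]

/-- `log |f|`; `Real.log` is `log |·|`, and the derivatives of `log |f|` are those of `log f` for
either sign of `f`. -/
def logAbs (f : Field) : Field := fun x y t => Real.log |f x y t|

/-! ### The (2+1)-dimensional Kaup–Kuperschmidt equation -/

/-- `u` is a smooth solution on `ℝ³` of the (2+1)-dimensional Kaup–Kuperschmidt equation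
`u_t = 5/9 (∂ₓ⁻¹u_yy + 3 u_x ∂ₓ⁻¹u_y - 1/5 u_xxxxx - 3 u u_xxx - 15/2 u_x u_xx - 9 u² u_x
  + u_xxy + 3 u u_y)`,
where `w` is the `x`-primitive of `u_y` that is denoted by `∂ₓ⁻¹u_y`, and `∂ₓ⁻¹u_yy` is `w_y`. -/
def IsKKSolution (u w : Field) : Prop :=
  Smooth u ∧ Smooth w ∧ dx w = dy u ∧
    ∀ x y t, dt u x y t = 5 / 9 * (dy w x y t + 3 * dx u x y t * w x y t
      - 1 / 5 * (dx^[5] u) x y t - 3 * u x y t * (dx^[3] u) x y t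
      - 15 / 2 * dx u x y t * (dx^[2] u) x y t - 9 * u x y t ^ 2 * dx u x y t
      + dy (dx^[2] u) x y t + 3 * u x y t * dy u x y t)

end CKP

end

noncomputable section

namespace CKP

/-! ### Calculus of smooth fields -/

namespace Smooth

variable {f g : Field}

/-! The relation between `α` and `β` is the implicit form of the rational curve `α = a³ + 3a`, `β =
a⁵ + 5a³ + 15a`, and the quotient defining `a` recovers the parameter. Each exponential therefore
obeys the two dispersion relations of the seed, which makes both sums eigenfunctions
(`Relation.alpha_eq`, `Relation.beta_eq`).

Let `V` be the vector `(φ, ψ)`, `Vᵢ` its `i`-th `x`-derivative and `M` the symmetric matrix of the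
primitives of `φ²`, `φψ`, `ψ²`. The determinant in question is `-det M`. In `x`, `M` has the
rank-one derivative `V₀V₀ᵀ`; its `y`- and `t`-derivatives are bilinear in the `Vᵢ` too, because `α i
+ α j` and `β i + β j` are divisible by `a i + a j`. Hence the scalars `Sᵢⱼ = Vᵢᵀ M⁻¹ Vⱼ` form a
closed differential system (`isPotentialFamily`), by `(M⁻¹)' = -M⁻¹ M' M⁻¹`. Jacobi's formula gives
`(log |det M|)ₓ = S₀₀`, so all derivatives in the Kaup–Kuperschmidt equation are polynomials in the
`Sᵢⱼ`. The equation becomes a polynomial identity that uses only the closed system and `Sᵢⱼ = Sⱼᵢ`,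
not the size of `M` (`dt_jet_two`).

Smoothness needs `det M ≠ 0`. For positive exponents `M` is the Gram matrix of `φ`, `ψ` in `L²(-∞,
x]`, and strict Cauchy–Schwarz gives `det M > 0`: proportionality is excluded because the separated
exponents force a positive Wronskian (`gram_pos_of_pos`). Reflecting `(x, y, t)` through the origin
reduces negative exponents to this case. -/

theorem add (hf : Smooth f) (hg : Smooth g) : Smooth (f + g) := ContDiff.add hf hg

theorem sub (hf : Smooth f) (hg : Smooth g) : Smooth (f - g) := ContDiff.sub hf hg

theorem mul (hf : Smooth f) (hg : Smooth g) : Smooth (f * g) := ContDiff.mul hf hg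

theorem pow (hf : Smooth f) (n : ℕ) : Smooth (f ^ n) := ContDiff.pow hf n

theorem ofNat (n : ℕ) [n.AtLeastTwo] : Smooth (ofNat(n) : Field) := contDiff_const

theorem one : Smooth (1 : Field) := contDiff_const

theorem differentiableAt_x (hf : Smooth f) (x y t : ℝ) :
    DifferentiableAt ℝ (fun s => f s y t) x := by
  have h : ContDiff ℝ ∞ (fun s : ℝ => ((s, y, t) : ℝ × ℝ × ℝ)) := by fun_prop
  exact (ContDiff.comp hf h).differentiable (by simp) x

theorem differentiableAt_y (hf : Smooth f) (x y t : ℝ) :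
    DifferentiableAt ℝ (fun s => f x s t) y := by
  have h : ContDiff ℝ ∞ (fun s : ℝ => ((x, s, t) : ℝ × ℝ × ℝ)) := by fun_prop
  exact (ContDiff.comp hf h).differentiable (by simp) y

theorem differentiableAt_t (hf : Smooth f) (x y t : ℝ) :
    DifferentiableAt ℝ (fun s => f x y s) t := by
  have h : ContDiff ℝ ∞ (fun s : ℝ => ((x, y, s) : ℝ × ℝ × ℝ)) := by fun_prop
  exact (ContDiff.comp hf h).differentiable (by simp) t

end Smooth

theorem dx_add {f g : Field} (hf : Smooth f) (hg : Smooth g) : dx (f + g) = dx f + dx g := by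
  funext x y t
  exact deriv_fun_add (hf.differentiableAt_x x y t) (hg.differentiableAt_x x y t)

theorem dx_sub {f g : Field} (hf : Smooth f) (hg : Smooth g) : dx (f - g) = dx f - dx g := by
  funext x y t
  exact deriv_fun_sub (hf.differentiableAt_x x y t) (hg.differentiableAt_x x y t)

theorem dx_mul {f g : Field} (hf : Smooth f) (hg : Smooth g) :
    dx (f * g) = dx f * g + f * dx g := by
  funext x y t
  exact deriv_fun_mul (hf.differentiableAt_x x y t) (hg.differentiableAt_x x y t)

theorem dx_pow {f : Field} (hf : Smooth f) (n : ℕ) :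
    dx (f ^ n) = (n : Field) * f ^ (n - 1) * dx f := by
  funext x y t
  exact deriv_fun_pow (hf.differentiableAt_x x y t) n

theorem dx_ofNat (n : ℕ) [n.AtLeastTwo] : dx (ofNat(n) : Field) = 0 := by
  funext x y t
  exact deriv_const _ _

theorem dx_one : dx (1 : Field) = 0 := by
  funext x y t
  exact deriv_const _ _

theorem dy_add {f g : Field} (hf : Smooth f) (hg : Smooth g) : dy (f + g) = dy f + dy g := by
  funext x y t
  exact deriv_fun_add (hf.differentiableAt_y x y t) (hg.differentiableAt_y x y t)

theorem dy_sub {f g : Field} (hf : Smooth f) (hg : Smooth g) : dy (f - g) = dy f - dy g := by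
  funext x y t
  exact deriv_fun_sub (hf.differentiableAt_y x y t) (hg.differentiableAt_y x y t)

theorem dy_mul {f g : Field} (hf : Smooth f) (hg : Smooth g) :
    dy (f * g) = dy f * g + f * dy g := by
  funext x y t
  exact deriv_fun_mul (hf.differentiableAt_y x y t) (hg.differentiableAt_y x y t)

theorem dy_pow {f : Field} (hf : Smooth f) (n : ℕ) :
    dy (f ^ n) = (n : Field) * f ^ (n - 1) * dy f := by
  funext x y t
  exact deriv_fun_pow (hf.differentiableAt_y x y t) n

theorem dy_ofNat (n : ℕ) [n.AtLeastTwo] : dy (ofNat(n) : Field) = 0 := by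
  funext x y t
  exact deriv_const _ _

theorem dy_one : dy (1 : Field) = 0 := by
  funext x y t
  exact deriv_const _ _

theorem dt_add {f g : Field} (hf : Smooth f) (hg : Smooth g) : dt (f + g) = dt f + dt g := by
  funext x y t
  exact deriv_fun_add (hf.differentiableAt_t x y t) (hg.differentiableAt_t x y t)

theorem dt_sub {f g : Field} (hf : Smooth f) (hg : Smooth g) : dt (f - g) = dt f - dt g := by
  funext x y t
  exact deriv_fun_sub (hf.differentiableAt_t x y t) (hg.differentiableAt_t x y t)

theorem dt_mul {f g : Field} (hf : Smooth f) (hg : Smooth g) :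
    dt (f * g) = dt f * g + f * dt g := by
  funext x y t
  exact deriv_fun_mul (hf.differentiableAt_t x y t) (hg.differentiableAt_t x y t)

theorem dt_pow {f : Field} (hf : Smooth f) (n : ℕ) :
    dt (f ^ n) = (n : Field) * f ^ (n - 1) * dt f := by
  funext x y t
  exact deriv_fun_pow (hf.differentiableAt_t x y t) n

theorem dt_ofNat (n : ℕ) [n.AtLeastTwo] : dt (ofNat(n) : Field) = 0 := by
  funext x y t
  exact deriv_const _ _

theorem dt_one : dt (1 : Field) = 0 := by
  funext x y t
  exact deriv_const _ _

/-! ### The Kaup–Kuperschmidt equation for squared eigenfunction potentials -/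

/-- A family `S i j` of smooth fields that evolves like `Vᵢᵀ M⁻¹ Vⱼ`, where `Vᵢ` is the `i`-th
`x`-derivative of a vector of seed eigenfunctions and `M` is their matrix of squared eigenfunction
potentials, so that `∂ₓ M = V₀ V₀ᵀ`. -/
structure IsPotentialFamily (S : ℕ → ℕ → Field) : Prop where
  smooth : ∀ i j, Smooth (S i j)
  symm : ∀ i j, S i j = S j i
  dx_eq : ∀ i j, dx (S i j) = S (i + 1) j + S i (j + 1) - S i 0 * S 0 j
  dy_eq : ∀ i j, dy (S i j) = S (i + 3) j + S i (j + 3) + 3 * (S (i + 1) j + S i (j + 1)) -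
    (S i 0 * S 2 j + S i 2 * S 0 j - S i 1 * S 1 j + 3 * (S i 0 * S 0 j))
  dt_eq : ∀ i j, dt (S i j) = S (i + 5) j + S i (j + 5) + 5 * (S (i + 3) j + S i (j + 3)) +
    15 * (S (i + 1) j + S i (j + 1)) -
    (S i 0 * S 4 j + S i 4 * S 0 j - S i 1 * S 3 j - S i 3 * S 1 j + S i 2 * S 2 j +
      5 * (S i 0 * S 2 j + S i 2 * S 0 j - S i 1 * S 1 j) + 15 * (S i 0 * S 0 j))

namespace IsPotentialFamily

variable {S : ℕ → ℕ → Field}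

/-- The `k`-th `x`-derivative, for `1 ≤ k ≤ 7`, of a function whose `x`-derivative is `S 0 0`. -/
def jet (S : ℕ → ℕ → Field) : ℕ → Field
  | 1 => S 0 0
  | 2 => 2 * S 0 1 - S 0 0 ^ 2
  | 3 => 2 * S 0 2 + 2 * S 1 1 - 6 * S 0 0 * S 0 1 + 2 * S 0 0 ^ 3
  | 4 =>
      2 * S 0 3 + 6 * S 1 2 - 8 * S 0 0 * S 0 2 - 6 * S 0 0 * S 1 1 - 14 * S 0 1 ^ 2 + 24
      * S 0 0 ^ 2 * S 0 1 - 6 * S 0 0 ^ 4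
  | 5 =>
      2 * S 0 4 + 8 * S 1 3 + 6 * S 2 2 - 10 * S 0 0 * S 0 3 - 20 * S 0 0 * S 1 2 - 50 * S 0 1
      * S 0 2 - 40 * S 0 1 * S 1 1 + 40 * S 0 0 ^ 2 * S 0 2 + 30 * S 0 0 ^ 2 * S 1 1 + 130
      * S 0 0 * S 0 1 ^ 2 - 120 * S 0 0 ^ 3 * S 0 1 + 24 * S 0 0 ^ 5
  | 6 =>
      2 * S 0 5 + 10 * S 1 4 + 20 * S 2 3 - 12 * S 0 0 * S 0 4 - 30 * S 0 0 * S 1 3 - 20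
      * S 0 0 * S 2 2 - 78 * S 0 1 * S 0 3 - 170 * S 0 1 * S 1 2 - 56 * S 0 2 ^ 2 - 90 * S 0 2
      * S 1 1 - 40 * S 1 1 ^ 2 + 60 * S 0 0 ^ 2 * S 0 3 + 120 * S 0 0 ^ 2 * S 1 2 + 540
      * S 0 0 * S 0 1 * S 0 2 + 420 * S 0 0 * S 0 1 * S 1 1 + 300 * S 0 1 ^ 3 - 240
      * S 0 0 ^ 3 * S 0 2 - 180 * S 0 0 ^ 3 * S 1 1 - 1140 * S 0 0 ^ 2 * S 0 1 ^ 2 + 720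
      * S 0 0 ^ 4 * S 0 1 - 120 * S 0 0 ^ 6
  | 7 =>
      2 * S 0 6 + 12 * S 1 5 + 30 * S 2 4 + 20 * S 3 3 - 14 * S 0 0 * S 0 5 - 42 * S 0 0
      * S 1 4 - 70 * S 0 0 * S 2 3 - 112 * S 0 1 * S 0 4 - 308 * S 0 1 * S 1 3 - 210 * S 0 1
      * S 2 2 - 210 * S 0 2 * S 0 3 - 462 * S 0 2 * S 1 2 - 168 * S 0 3 * S 1 1 - 420 * S 1 1
      * S 1 2 + 84 * S 0 0 ^ 2 * S 0 4 + 210 * S 0 0 ^ 2 * S 1 3 + 140 * S 0 0 ^ 2 * S 2 2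
      + 966 * S 0 0 * S 0 1 * S 0 3 + 2030 * S 0 0 * S 0 1 * S 1 2 + 672 * S 0 0 * S 0 2 ^ 2
      + 1050 * S 0 0 * S 0 2 * S 1 1 + 420 * S 0 0 * S 1 1 ^ 2 + 2240 * S 0 1 ^ 2 * S 0 2
      + 1820 * S 0 1 ^ 2 * S 1 1 - 420 * S 0 0 ^ 3 * S 0 3 - 840 * S 0 0 ^ 3 * S 1 2 - 5460
      * S 0 0 ^ 2 * S 0 1 * S 0 2 - 4200 * S 0 0 ^ 2 * S 0 1 * S 1 1 - 5880 * S 0 0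
      * S 0 1 ^ 3 + 1680 * S 0 0 ^ 4 * S 0 2 + 1260 * S 0 0 ^ 4 * S 1 1 + 10500 * S 0 0 ^ 3
      * S 0 1 ^ 2 - 5040 * S 0 0 ^ 5 * S 0 1 + 720 * S 0 0 ^ 7
  | _ => 0

theorem dx_jet_one (h : IsPotentialFamily S) : dx (jet S 1) = jet S 2 := by
  simp (maxDischargeDepth := 50) only [jet, h.dx_eq, zero_add, h.symm 1 0]
  ring

theorem dx_jet_two (h : IsPotentialFamily S) : dx (jet S 2) = jet S 3 := by
  -- Only the instances of symmetry that sort indices into `i ≤ j` are used, so that equal monomials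
  -- look equal to `ring`; the general law would also undo the sorting. The same device serves the
  -- later jet computations.
  simp (maxDischargeDepth := 50) only [jet, dx_sub, dx_mul, dx_pow, dx_ofNat, h.dx_eq, h.smooth,
    Smooth.mul, Smooth.pow, Smooth.ofNat, Nat.reduceAdd, Nat.cast_ofNat, zero_add, h.symm 1 0]
  ring

theorem dx_jet_three (h : IsPotentialFamily S) : dx (jet S 3) = jet S 4 := by
  simp (maxDischargeDepth := 50) only [jet, dx_add, dx_sub, dx_mul, dx_pow, dx_ofNat, h.dx_eq,
    h.smooth, Smooth.add, Smooth.sub, Smooth.mul, Smooth.pow, Smooth.ofNat, Nat.reduceAdd,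
    Nat.cast_ofNat, zero_add, h.symm 1 0, h.symm 2 1]
  ring

theorem dx_jet_four (h : IsPotentialFamily S) : dx (jet S 4) = jet S 5 := by
  simp (maxDischargeDepth := 50) only [jet, dx_add, dx_sub, dx_mul, dx_pow, dx_ofNat, h.dx_eq,
    h.smooth, Smooth.add, Smooth.sub, Smooth.mul, Smooth.pow, Smooth.ofNat, Nat.reduceAdd,
    Nat.cast_ofNat, zero_add, h.symm 1 0, h.symm 2 1]
  ring

theorem dx_jet_five (h : IsPotentialFamily S) : dx (jet S 5) = jet S 6 := by
  simp (maxDischargeDepth := 50) only [jet, dx_add, dx_sub, dx_mul, dx_pow, dx_ofNat, h.dx_eq,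
    h.smooth, Smooth.add, Smooth.sub, Smooth.mul, Smooth.pow, Smooth.ofNat, Nat.reduceAdd,
    Nat.cast_ofNat, zero_add, h.symm 1 0, h.symm 2 0, h.symm 2 1, h.symm 3 2]
  ring

theorem dx_jet_six (h : IsPotentialFamily S) : dx (jet S 6) = jet S 7 := by
  simp (maxDischargeDepth := 50) only [jet, dx_add, dx_sub, dx_mul, dx_pow, dx_ofNat, h.dx_eq,
    h.smooth, Smooth.add, Smooth.sub, Smooth.mul, Smooth.pow, Smooth.ofNat, Nat.reduceAdd,
    Nat.cast_ofNat, zero_add, h.symm 1 0, h.symm 2 0, h.symm 2 1, h.symm 3 2]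
  ring

theorem smooth_jet_two (h : IsPotentialFamily S) : Smooth (jet S 2) := by
  simp only [jet, h.smooth, Smooth.sub, Smooth.mul, Smooth.pow, Smooth.ofNat]

/-- Compatibility of the `x`- and `y`-flows, read off from the closed system itself; it makes `dy (S
0 0)` an `x`-primitive of `u_y`. -/
theorem dx_dy_comm (h : IsPotentialFamily S) : dx (dy (S 0 0)) = dy (jet S 2) := by
  simp (maxDischargeDepth := 50) only [jet, dx_add, dx_sub, dx_mul, dx_ofNat, h.dx_eq, dy_sub,
    dy_mul, dy_pow, dy_ofNat, h.dy_eq, h.smooth, Smooth.add, Smooth.sub, Smooth.mul, Smooth.pow,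
    Smooth.ofNat, Nat.reduceAdd, Nat.cast_ofNat, zero_add, h.symm 1 0, h.symm 2 0, h.symm 2 1,
    h.symm 3 0, h.symm 3 1]
  ring

/-- The Kaup–Kuperschmidt equation for `u = 1 + jet S 2`, `w = 6 + dy (S 0 0)`, multiplied by 18 to
clear denominators. After expansion by the closed system it is an identity of polynomials in the `S
i j` with `i ≤ j`. -/
theorem dt_jet_two (h : IsPotentialFamily S) :
    18 * dt (jet S 2) = 10 * dy (dy (S 0 0)) + 30 * jet S 3 * (6 + dy (S 0 0)) - 2 * jet S 7 -
      30 * (1 + jet S 2) * jet S 5 - 75 * jet S 3 * jet S 4 - 90 * (1 + jet S 2) ^ 2 * jet S 3 +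
      10 * dy (jet S 4) + 30 * (1 + jet S 2) * dy (jet S 2) := by
  simp (maxDischargeDepth := 50) only [jet, dt_sub, dt_mul, dt_pow, dt_ofNat, h.dt_eq, dy_add,
    dy_sub, dy_mul, dy_pow, dy_ofNat, h.dy_eq, h.smooth, Smooth.add, Smooth.sub, Smooth.mul,
    Smooth.pow, Smooth.ofNat, Nat.reduceAdd, Nat.cast_ofNat, zero_add, h.symm 1 0, h.symm 2 0,
    h.symm 2 1, h.symm 3 0, h.symm 3 1, h.symm 3 2, h.symm 4 0, h.symm 4 1, h.symm 4 2, h.symm 5 0,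
    h.symm 5 1]
  ring

/-- The constants are the seed values: 1 and 6 are the coefficients of `∂⁻¹` in `L⁽⁰⁾` and in its
cube. -/
theorem isKKSolution (h : IsPotentialFamily S) :
    IsKKSolution (1 + jet S 2) (6 + dy (S 0 0)) := by
  have hj := h.smooth_jet_two
  have hw : Smooth (dy (S 0 0)) := by
    simp (maxDischargeDepth := 50) only [h.dy_eq, h.smooth, Smooth.add, Smooth.sub, Smooth.mul,
      Smooth.ofNat]
  have hx1 : dx (1 + jet S 2) = jet S 3 := by
    rw [dx_add Smooth.one hj, dx_one, zero_add, h.dx_jet_two]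
  have hx2 : dx^[2] (1 + jet S 2) = jet S 4 := by
    rw [Function.iterate_succ_apply, hx1, Function.iterate_one, h.dx_jet_three]
  have hx3 : dx^[3] (1 + jet S 2) = jet S 5 := by
    rw [Function.iterate_succ_apply', hx2, h.dx_jet_four]
  have hx5 : dx^[5] (1 + jet S 2) = jet S 7 := by
    rw [Function.iterate_succ_apply', Function.iterate_succ_apply', hx3, h.dx_jet_five, h.dx_jet_six]
  have hy : dy (1 + jet S 2) = dy (jet S 2) := by
    rw [dy_add Smooth.one hj, dy_one, zero_add]
  have ht : dt (1 + jet S 2) = dt (jet S 2) := by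
    rw [dt_add Smooth.one hj, dt_one, zero_add]
  have hwy : dy (6 + dy (S 0 0)) = dy (dy (S 0 0)) := by
    rw [dy_add (Smooth.ofNat 6) hw, dy_ofNat, zero_add]
  refine ⟨Smooth.one.add hj, (Smooth.ofNat 6).add hw, ?_, fun x y t => ?_⟩
  · rw [dx_add (Smooth.ofNat 6) hw, dx_ofNat, zero_add, hy, h.dx_dy_comm]
  · rw [hx1, hx2, hx3, hx5, hy, ht, hwy]
    have key := congrFun (congrFun (congrFun h.dt_jet_two x) y) t
    simp only [Pi.add_apply, Pi.sub_apply, Pi.mul_apply, Pi.pow_apply, Pi.ofNat_apply] at key ⊢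
    linear_combination key / 18

end IsPotentialFamily

/-! ### Inverses and logarithms of nowhere vanishing fields -/

namespace Smooth

theorem inv {f : Field} (hf : Smooth f) (h0 : ∀ x y t, f x y t ≠ 0) : Smooth f⁻¹ :=
  ContDiff.inv hf fun p => h0 p.1 p.2.1 p.2.2

end Smooth

theorem dx_inv {f : Field} (hf : Smooth f) (h0 : ∀ x y t, f x y t ≠ 0) :
    dx f⁻¹ = -(dx f * f⁻¹ ^ 2) := by
  funext x y t
  refine (deriv_fun_inv'' (hf.differentiableAt_x x y t) (h0 x y t)).trans ?_
  simp only [dx, Pi.neg_apply, Pi.mul_apply, Pi.pow_apply, Pi.inv_apply, inv_pow, neg_mul,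
    div_eq_mul_inv]

theorem dy_inv {f : Field} (hf : Smooth f) (h0 : ∀ x y t, f x y t ≠ 0) :
    dy f⁻¹ = -(dy f * f⁻¹ ^ 2) := by
  funext x y t
  refine (deriv_fun_inv'' (hf.differentiableAt_y x y t) (h0 x y t)).trans ?_
  simp only [dy, Pi.neg_apply, Pi.mul_apply, Pi.pow_apply, Pi.inv_apply, inv_pow, neg_mul,
    div_eq_mul_inv]

theorem dt_inv {f : Field} (hf : Smooth f) (h0 : ∀ x y t, f x y t ≠ 0) :
    dt f⁻¹ = -(dt f * f⁻¹ ^ 2) := by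
  funext x y t
  refine (deriv_fun_inv'' (hf.differentiableAt_t x y t) (h0 x y t)).trans ?_
  simp only [dt, Pi.neg_apply, Pi.mul_apply, Pi.pow_apply, Pi.inv_apply, inv_pow, neg_mul,
    div_eq_mul_inv]

theorem dx_logAbs {f : Field} (hf : Smooth f) (h0 : ∀ x y t, f x y t ≠ 0) :
    dx (logAbs f) = dx f * f⁻¹ := by
  funext x y t
  simp only [dx, logAbs, Real.log_abs, Pi.mul_apply, Pi.inv_apply]
  rw [deriv.log (hf.differentiableAt_x x y t) (h0 x y t), div_eq_mul_inv]

theorem logAbs_neg (f : Field) : logAbs (-f) = logAbs f := by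
  funext x y t
  simp only [logAbs, Pi.neg_apply, abs_neg]

/-! ### The seed operators -/

/-- The seed series is `(1 - X²)⁻¹`, and its cube begins `1 + 3X²`. -/
theorem seedB_three (f : Field) : seedB 3 f = dx^[3] f + 3 * dx f := by
  funext x y t
  simp [seedB, seedSeries, Finset.sum_range_succ, pow_succ, PowerSeries.coeff_mul,
    Finset.Nat.antidiagonal_succ, PowerSeries.coeff_mk, Nat.even_iff]
  ring

theorem seedB_five (f : Field) : seedB 5 f = dx^[5] f + 5 * dx^[3] f + 15 * dx f := by
  funext x y t
  simp [seedB, seedSeries, Finset.sum_range_succ, pow_succ, PowerSeries.coeff_mul,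
    Finset.Nat.antidiagonal_succ, PowerSeries.coeff_mk, Nat.even_iff]
  ring

namespace ExpSum

/-! ### Dispersion relations -/

/-- Division by zero returns 0, so a vanishing denominator would give `a j = 0`; the sign condition
on the exponents thus already excludes it. -/
theorem denominator_ne_zero {φ : ExpSum} {j : Fin φ.n} (h : φ.a j ≠ 0) :
    φ.α j ^ 2 + φ.α j * φ.β j + 81 ≠ 0 := by
  intro h0
  exact h (by rw [a, h0, div_zero])

theorem Relation.alpha_eq {φ : ExpSum} (hr : φ.Relation) {j : Fin φ.n} (h : φ.a j ≠ 0) :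
    φ.α j = φ.a j ^ 3 + 3 * φ.a j := by
  have hD := denominator_ne_zero h
  have hR := hr j
  have hA := div_mul_cancel₀ (φ.α j ^ 3 - 18 * φ.α j + 9 * φ.β j) hD
  rw [← a] at hA
  generalize φ.a j = c at hA ⊢
  generalize φ.α j = a at *
  generalize φ.β j = b at *
  refine mul_right_cancel₀ (pow_ne_zero 3 hD) ?_
  -- With `N` and `D` the numerator and denominator of the exponent, `αD³ - N³ - 3ND²` is a multiple
  -- of the relation; the coefficient below is minus the quotient of `N³ + 3ND² - αD³`, taken with
  -- the sign that this requires.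
  transitivity (a ^ 3 - 18 * a + 9 * b) ^ 3 + 3 * (a ^ 3 - 18 * a + 9 * b) * (a ^ 2 + a * b + 81) ^ 2
  · linear_combination -(-729 - 27 * a ^ 2 + a ^ 4) * hR
  · rw [← hA]
    ring

theorem Relation.beta_eq {φ : ExpSum} (hr : φ.Relation) {j : Fin φ.n} (h : φ.a j ≠ 0) :
    φ.β j = φ.a j ^ 5 + 5 * φ.a j ^ 3 + 15 * φ.a j := by
  have hD := denominator_ne_zero h
  have hR := hr j
  have hA := div_mul_cancel₀ (φ.α j ^ 3 - 18 * φ.α j + 9 * φ.β j) hD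
  rw [← a] at hA
  generalize φ.a j = c at hA ⊢
  generalize φ.α j = a at *
  generalize φ.β j = b at *
  refine mul_right_cancel₀ (pow_ne_zero 5 hD) ?_
  -- As for `α`: `βD⁵ - N⁵ - 5N³D² - 15ND⁴` is a multiple of the relation, and the long factor is
  -- the cofactor up to sign.
  transitivity (a ^ 3 - 18 * a + 9 * b) ^ 5 + 5 * (a ^ 3 - 18 * a + 9 * b) ^ 3 *
      (a ^ 2 + a * b + 81) ^ 2 + 15 * (a ^ 3 - 18 * a + 9 * b) * (a ^ 2 + a * b + 81) ^ 4
  · linear_combination -(-9565938 - 295245 * a ^ 2 - 59049 * b ^ 2 + 40095 * a ^ 4 +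
      3645 * a ^ 3 * b - 3645 * a ^ 2 * b ^ 2 + 1080 * a ^ 6 - 108 * a ^ 5 * b +
      270 * a ^ 4 * b ^ 2 - 60 * a ^ 8 + 25 * a ^ 7 * b + 5 * a ^ 6 * b ^ 2 +
      a ^ 5 * b ^ 3 + a ^ 10) * hR
  · rw [← hA]
    ring

/-! ### Derivatives of exponential sums -/

/-- The sum of exponentials `∑ j, k_j * a_j ^ m * exp (a_j x + α_j y + β_j t)`, that is, the
`m`-th `x`-derivative of `φ.eval`. -/
def moment (φ : ExpSum) (m : ℕ) : Field := fun x y t =>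
  ∑ j, φ.k j * φ.a j ^ m * Real.exp (φ.a j * x + φ.α j * y + φ.β j * t)

theorem moment_zero (φ : ExpSum) : φ.moment 0 = φ.eval := by
  funext x y t
  simp only [moment, eval, pow_zero, mul_one]

theorem smooth_moment (φ : ExpSum) (m : ℕ) : Smooth (φ.moment m) := by
  unfold Smooth moment
  fun_prop

theorem smooth_intMul (φ ψ : ExpSum) : Smooth (φ.intMul ψ) := by
  unfold Smooth intMul
  fun_prop

theorem moment_mul_moment (φ ψ : ExpSum) (l m : ℕ) (x y t : ℝ) :
    φ.moment l x y t * ψ.moment m x y t =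
      ∑ i, ∑ j, φ.k i * ψ.k j * (φ.a i ^ l * ψ.a j ^ m) *
        Real.exp ((φ.a i + ψ.a j) * x + (φ.α i + ψ.α j) * y + (φ.β i + ψ.β j) * t) := by
  simp only [moment, Finset.sum_mul_sum]
  refine Finset.sum_congr rfl fun i _ => Finset.sum_congr rfl fun j _ => ?_
  have he : Real.exp ((φ.a i + ψ.a j) * x + (φ.α i + ψ.α j) * y + (φ.β i + ψ.β j) * t) =
      Real.exp (φ.a i * x + φ.α i * y + φ.β i * t) *
        Real.exp (ψ.a j * x + ψ.α j * y + ψ.β j * t) := by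
    rw [← Real.exp_add]
    congr 1
    ring
  rw [he]
  ring

theorem hasDerivAt_exp_linear {c d : ℝ} (s : ℝ) (g : ℝ → ℝ) (hg : ∀ s, g s = c * s + d) :
    HasDerivAt (fun s => Real.exp (g s)) (Real.exp (g s) * c) s := by
  have h : HasDerivAt g c s := by
    rw [funext hg]
    simpa using ((hasDerivAt_id s).const_mul c).add_const d
  exact h.exp

theorem dx_moment (φ : ExpSum) (m : ℕ) : dx (φ.moment m) = φ.moment (m + 1) := by
  funext x y t
  refine HasDerivAt.deriv ?_
  unfold moment
  refine HasDerivAt.fun_sum fun j _ => ?_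
  refine HasDerivAt.congr_deriv ((hasDerivAt_exp_linear (c := φ.a j) (d := φ.α j * y + φ.β j * t) x
    (fun s => φ.a j * s + φ.α j * y + φ.β j * t) fun s => by ring).const_mul
      (φ.k j * φ.a j ^ m)) ?_
  ring

theorem iterate_dx_moment (φ : ExpSum) (l m : ℕ) :
    dx^[l] (φ.moment m) = φ.moment (m + l) := by
  induction l with
  | zero => rfl
  | succ l ih => rw [Function.iterate_succ_apply', ih, dx_moment, add_assoc]

theorem dy_moment {φ : ExpSum} (hα : ∀ j, φ.α j = φ.a j ^ 3 + 3 * φ.a j) (m : ℕ) :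
    dy (φ.moment m) = φ.moment (m + 3) + 3 * φ.moment (m + 1) := by
  funext x y t
  refine HasDerivAt.deriv ?_
  simp only [Pi.add_apply, Pi.mul_apply, Pi.ofNat_apply, moment, Finset.mul_sum,
    ← Finset.sum_add_distrib]
  refine HasDerivAt.fun_sum fun j _ => ?_
  refine HasDerivAt.congr_deriv ((hasDerivAt_exp_linear (c := φ.α j) (d := φ.a j * x + φ.β j * t) y
    (fun s => φ.a j * x + φ.α j * s + φ.β j * t) fun s => by ring).const_mul
      (φ.k j * φ.a j ^ m)) ?_
  linear_combination (φ.k j * φ.a j ^ m *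
    Real.exp (φ.a j * x + φ.α j * y + φ.β j * t)) * hα j

theorem dt_moment {φ : ExpSum} (hβ : ∀ j, φ.β j = φ.a j ^ 5 + 5 * φ.a j ^ 3 + 15 * φ.a j)
    (m : ℕ) :
    dt (φ.moment m) = φ.moment (m + 5) + 5 * φ.moment (m + 3) + 15 * φ.moment (m + 1) := by
  funext x y t
  refine HasDerivAt.deriv ?_
  simp only [Pi.add_apply, Pi.mul_apply, Pi.ofNat_apply, moment, Finset.mul_sum,
    ← Finset.sum_add_distrib]
  refine HasDerivAt.fun_sum fun j _ => ?_
  refine HasDerivAt.congr_deriv ((hasDerivAt_exp_linear (c := φ.β j) (d := φ.a j * x + φ.α j * y) t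
    (fun s => φ.a j * x + φ.α j * y + φ.β j * s) fun s => by ring).const_mul
      (φ.k j * φ.a j ^ m)) ?_
  linear_combination (φ.k j * φ.a j ^ m *
    Real.exp (φ.a j * x + φ.α j * y + φ.β j * t)) * hβ j

theorem isSeedEigenfunction {φ : ExpSum} (hα : ∀ j, φ.α j = φ.a j ^ 3 + 3 * φ.a j)
    (hβ : ∀ j, φ.β j = φ.a j ^ 5 + 5 * φ.a j ^ 3 + 15 * φ.a j) :
    IsSeedEigenfunction φ.eval := by
  rw [← moment_zero]
  refine ⟨φ.smooth_moment 0, ?_, ?_⟩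
  · rw [seedB_three, dy_moment hα, iterate_dx_moment, dx_moment]
  · rw [seedB_five, dt_moment hβ, iterate_dx_moment, iterate_dx_moment, dx_moment]

theorem dx_intMul {φ ψ : ExpSum} (h : ∀ i j, φ.a i + ψ.a j ≠ 0) :
    dx (φ.intMul ψ) = φ.moment 0 * ψ.moment 0 := by
  funext x y t
  rw [moment_zero, moment_zero]
  exact (φ.hasDerivAt_intMul ψ h x y t).deriv

/-- The factorisation `(p³ + 3p) + (q³ + 3q) = (p + q)(p² - pq + q² + 3)` cancels the denominator `p
+ q` of the primitive. -/
theorem dy_intMul {φ ψ : ExpSum} (h : ∀ i j, φ.a i + ψ.a j ≠ 0)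
    (hφ : ∀ j, φ.α j = φ.a j ^ 3 + 3 * φ.a j) (hψ : ∀ j, ψ.α j = ψ.a j ^ 3 + 3 * ψ.a j) :
    dy (φ.intMul ψ) = φ.moment 0 * ψ.moment 2 + φ.moment 2 * ψ.moment 0 -
      φ.moment 1 * ψ.moment 1 + 3 * (φ.moment 0 * ψ.moment 0) := by
  funext x y t
  refine HasDerivAt.deriv ?_
  simp only [Pi.add_apply, Pi.sub_apply, Pi.mul_apply, Pi.ofNat_apply, moment_mul_moment, intMul,
    Finset.mul_sum, ← Finset.sum_add_distrib, ← Finset.sum_sub_distrib]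
  refine HasDerivAt.fun_sum fun i _ => HasDerivAt.fun_sum fun j _ => ?_
  refine HasDerivAt.congr_deriv (((hasDerivAt_exp_linear (c := φ.α i + ψ.α j)
    (d := (φ.a i + ψ.a j) * x + (φ.β i + ψ.β j) * t) y
    (fun s => (φ.a i + ψ.a j) * x + (φ.α i + ψ.α j) * s + (φ.β i + ψ.β j) * t)
    fun s => by ring).const_mul (φ.k i * ψ.k j)).div_const (φ.a i + ψ.a j)) ?_
  rw [div_eq_iff (h i j)]
  linear_combination (φ.k i * ψ.k j * Real.exp
    ((φ.a i + ψ.a j) * x + (φ.α i + ψ.α j) * y + (φ.β i + ψ.β j) * t)) * (hφ i + hψ j)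

/-- Here `p + q` divides the sum of the `t`-exponents, with quotient `p⁴ - p³q + p²q² - pq³ + q⁴ +
5(p² - pq + q²) + 15`. -/
theorem dt_intMul {φ ψ : ExpSum} (h : ∀ i j, φ.a i + ψ.a j ≠ 0)
    (hφ : ∀ j, φ.β j = φ.a j ^ 5 + 5 * φ.a j ^ 3 + 15 * φ.a j)
    (hψ : ∀ j, ψ.β j = ψ.a j ^ 5 + 5 * ψ.a j ^ 3 + 15 * ψ.a j) :
    dt (φ.intMul ψ) = φ.moment 0 * ψ.moment 4 + φ.moment 4 * ψ.moment 0 -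
      φ.moment 1 * ψ.moment 3 - φ.moment 3 * ψ.moment 1 + φ.moment 2 * ψ.moment 2 +
      5 * (φ.moment 0 * ψ.moment 2 + φ.moment 2 * ψ.moment 0 - φ.moment 1 * ψ.moment 1) +
      15 * (φ.moment 0 * ψ.moment 0) := by
  funext x y t
  refine HasDerivAt.deriv ?_
  simp only [Pi.add_apply, Pi.sub_apply, Pi.mul_apply, Pi.ofNat_apply, moment_mul_moment, intMul,
    Finset.mul_sum, ← Finset.sum_add_distrib, ← Finset.sum_sub_distrib]
  refine HasDerivAt.fun_sum fun i _ => HasDerivAt.fun_sum fun j _ => ?_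
  refine HasDerivAt.congr_deriv (((hasDerivAt_exp_linear (c := φ.β i + ψ.β j)
    (d := (φ.a i + ψ.a j) * x + (φ.α i + ψ.α j) * y) t
    (fun s => (φ.a i + ψ.a j) * x + (φ.α i + ψ.α j) * y + (φ.β i + ψ.β j) * s)
    fun s => by ring).const_mul (φ.k i * ψ.k j)).div_const (φ.a i + ψ.a j)) ?_
  rw [div_eq_iff (h i j)]
  linear_combination (φ.k i * ψ.k j * Real.exp
    ((φ.a i + ψ.a j) * x + (φ.α i + ψ.α j) * y + (φ.β i + ψ.β j) * t)) * (hφ i + hψ j)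

theorem intMul_comm (φ ψ : ExpSum) : φ.intMul ψ = ψ.intMul φ := by
  funext x y t
  rw [intMul, Finset.sum_comm, intMul]
  refine Finset.sum_congr rfl fun i _ => Finset.sum_congr rfl fun j _ => ?_
  simp only [add_comm (φ.a _), add_comm (φ.α _), add_comm (φ.β _), mul_comm (φ.k _)]

/-! ### The Gram determinant of the squared eigenfunction potentials -/

/-- The Gram determinant `∫φ² ∫ψ² - (∫φψ)²`. -/
def gram (φ ψ : ExpSum) : Field := φ.intMul φ * ψ.intMul ψ - φ.intMul ψ ^ 2

theorem gram_comm (φ ψ : ExpSum) : φ.gram ψ = ψ.gram φ := by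
  rw [gram, gram, intMul_comm φ ψ, mul_comm]

theorem IW22_eq_neg_gram (φ ψ : ExpSum) : IW22 ψ φ φ ψ = -φ.gram ψ := by
  funext x y t
  rw [IW22, intMul_comm ψ φ, Matrix.det_fin_two_of]
  simp only [gram, Pi.neg_apply, Pi.sub_apply, Pi.mul_apply, Pi.pow_apply]
  ring

theorem smooth_gram (φ ψ : ExpSum) : Smooth (φ.gram ψ) :=
  ((φ.smooth_intMul φ).mul (ψ.smooth_intMul ψ)).sub ((φ.smooth_intMul ψ).pow 2)

/-! ### Positivity of the Gram determinant -/

theorem intMul_pos {φ ψ : ExpSum} (hφn : 0 < φ.n) (hψn : 0 < ψ.n) (hkφ : ∀ i, 0 < φ.k i)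
    (hkψ : ∀ j, 0 < ψ.k j) (hφ : ∀ i, 0 < φ.a i) (hψ : ∀ j, 0 < ψ.a j) (x y t : ℝ) :
    0 < φ.intMul ψ x y t := by
  have : Nonempty (Fin φ.n) := ⟨⟨0, hφn⟩⟩
  have : Nonempty (Fin ψ.n) := ⟨⟨0, hψn⟩⟩
  refine Finset.sum_pos (fun i _ => Finset.sum_pos (fun j _ => ?_) Finset.univ_nonempty)
    Finset.univ_nonempty
  have := hkφ i
  have := hkψ j
  have := hφ i
  have := hψ j
  positivity

theorem integrableOn_eval_mul_eval {φ ψ : ExpSum} (hφ : ∀ i, 0 < φ.a i) (hψ : ∀ j, 0 < ψ.a j)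
    (x y t : ℝ) : IntegrableOn (fun s => φ.eval s y t * ψ.eval s y t) (Iic x) := by
  simp only [eval_mul_eval]
  refine integrable_finsetSum _ fun i _ => integrable_finsetSum _ fun j _ => ?_
  have h := (integrableOn_exp_mul_Iic (add_pos (hφ i) (hψ j)) x).const_mul
    (φ.k i * ψ.k j * Real.exp ((φ.α i + ψ.α j) * y + (φ.β i + ψ.β j) * t))
  refine h.congr (Filter.Eventually.of_forall fun s => ?_)
  beta_reduce
  rw [mul_assoc (φ.k i * ψ.k j), ← Real.exp_add]
  congr 2
  ring

/-- The Wronskian of two sums of exponentials is positive if every exponent of the first is smaller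
than every exponent of the second. -/
theorem wronskian_pos {φ ψ : ExpSum} (hφn : 0 < φ.n) (hψn : 0 < ψ.n) (hkφ : ∀ i, 0 < φ.k i)
    (hkψ : ∀ j, 0 < ψ.k j) (ha : ∀ i j, φ.a i < ψ.a j) (x y t : ℝ) :
    0 < φ.moment 0 x y t * ψ.moment 1 x y t - φ.moment 1 x y t * ψ.moment 0 x y t := by
  have : Nonempty (Fin φ.n) := ⟨⟨0, hφn⟩⟩
  have : Nonempty (Fin ψ.n) := ⟨⟨0, hψn⟩⟩
  simp only [moment_mul_moment, ← Finset.sum_sub_distrib, ← sub_mul, ← mul_sub]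
  refine Finset.sum_pos (fun i _ => Finset.sum_pos (fun j _ => ?_) Finset.univ_nonempty)
    Finset.univ_nonempty
  have := hkφ i
  have := hkψ j
  have : 0 < φ.a i ^ 0 * ψ.a j ^ 1 - φ.a i ^ 1 * ψ.a j ^ 0 := by
    simpa using ha i j
  positivity

/-- If `ψ = cφ` held to the left of `x`, then `ψₓ = cφₓ` there too, and the Wronskian would vanish
at the interior point `x - 1`. -/
theorem not_proportional {φ ψ : ExpSum} (hφn : 0 < φ.n) (hψn : 0 < ψ.n) (hkφ : ∀ i, 0 < φ.k i)
    (hkψ : ∀ j, 0 < ψ.k j) (ha : ∀ i j, φ.a i < ψ.a j) (c x y t : ℝ) :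
    ∃ s < x, ψ.eval s y t - c * φ.eval s y t ≠ 0 := by
  by_contra! h
  have he : (fun s => ψ.moment 0 s y t) =ᶠ[nhds (x - 1)] fun s => c * φ.moment 0 s y t := by
    filter_upwards [Iio_mem_nhds (show x - 1 < x by linarith)] with s hs
    rw [moment_zero, moment_zero]
    exact sub_eq_zero.mp (h s hs)
  have h0 := he.eq_of_nhds
  have h1 : dx (ψ.moment 0) (x - 1) y t = c * dx (φ.moment 0) (x - 1) y t :=
    he.deriv_eq.trans (deriv_const_mul _ ((φ.smooth_moment 0).differentiableAt_x _ y t))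
  rw [dx_moment, dx_moment] at h1
  have hW := wronskian_pos hφn hψn hkφ hkψ ha (x - 1) y t
  simp only [zero_add] at h0 h1
  rw [h0, h1] at hW
  linarith

theorem continuous_eval (φ : ExpSum) (y t : ℝ) : Continuous fun s => φ.eval s y t := by
  unfold eval
  fun_prop

/-- Strict Cauchy–Schwarz in `L²(-∞, x]`: the determinant is `∫φ²` times the squared distance of `ψ`
from the line spanned by `φ`. -/
theorem gram_pos_of_pos {φ ψ : ExpSum} (hφn : 0 < φ.n) (hψn : 0 < ψ.n) (hkφ : ∀ i, 0 < φ.k i)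
    (hkψ : ∀ j, 0 < ψ.k j) (ha : ∀ i j, φ.a i < ψ.a j) (hφ : ∀ i, 0 < φ.a i)
    (hψ : ∀ j, 0 < ψ.a j) (x y t : ℝ) : 0 < φ.gram ψ x y t := by
  have hF := intMul_pos hφn hφn hkφ hkφ hφ hφ x y t
  -- The coefficient of the orthogonal projection of `ψ` onto `φ`.
  set c := φ.intMul ψ x y t / φ.intMul φ x y t with hc
  have hiF := integrableOn_eval_mul_eval hφ hφ x y t
  have hiG := integrableOn_eval_mul_eval hφ hψ x y t
  have hiH := integrableOn_eval_mul_eval hψ hψ x y t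
  set f : ℝ → ℝ := fun s => (ψ.eval s y t - c * φ.eval s y t) ^ 2 with hf
  have hfe : f = fun s => ψ.eval s y t * ψ.eval s y t -
      2 * c * (φ.eval s y t * ψ.eval s y t) + c ^ 2 * (φ.eval s y t * φ.eval s y t) := by
    funext s
    simp only [hf]
    ring
  have hi1 : IntegrableOn (fun s => ψ.eval s y t * ψ.eval s y t -
      2 * c * (φ.eval s y t * ψ.eval s y t)) (Iic x) := hiH.sub (hiG.const_mul (2 * c))
  have hi2 := hiF.const_mul (c ^ 2)
  have hint : IntegrableOn f (Iic x) := by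
    rw [hfe]
    exact hi1.add hi2
  have hval : ∫ s in Iic x, f s = ψ.intMul ψ x y t - 2 * c * φ.intMul ψ x y t +
      c ^ 2 * φ.intMul φ x y t := by
    rw [hfe, intMul_eq_integral_Iic ψ ψ hψ hψ, intMul_eq_integral_Iic φ ψ hφ hψ,
      intMul_eq_integral_Iic φ φ hφ hφ, ← integral_const_mul, ← integral_const_mul,
      ← integral_sub hiH (hiG.const_mul _), ← integral_add hi1 hi2]
  have hcont : Continuous f :=
    ((ψ.continuous_eval y t).sub ((φ.continuous_eval y t).const_mul c)).pow 2
  have hpos : 0 < ∫ s in Iic x, f s := by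
    rw [setIntegral_pos_iff_support_of_nonneg_ae
      (Filter.Eventually.of_forall fun s => sq_nonneg _) hint]
    obtain ⟨s, hs, hne⟩ := not_proportional hφn hψn hkφ hkψ ha c x y t
    -- Passing to the open half-line makes the set open, and a nonempty open set has positive
    -- measure.
    refine lt_of_lt_of_le ?_ (measure_mono (inter_subset_inter_right _ Iio_subset_Iic_self))
    exact ((hcont.isOpen_support).inter isOpen_Iio).measure_pos _ ⟨s, pow_ne_zero 2 hne, hs⟩
  rw [hval] at hpos
  have hcF : c * φ.intMul φ x y t = φ.intMul ψ x y t := div_mul_cancel₀ _ hF.ne'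
  have hD : φ.gram ψ x y t = φ.intMul φ x y t * (ψ.intMul ψ x y t -
      2 * c * φ.intMul ψ x y t + c ^ 2 * φ.intMul φ x y t) := by
    simp only [gram, Pi.sub_apply, Pi.mul_apply, Pi.pow_apply]
    rw [← hcF]
    ring
  rw [hD]
  exact mul_pos hF hpos

/-- The exponential sum `(x, y, t) ↦ φ (-x, -y, -t)`. -/
abbrev reflect (φ : ExpSum) : ExpSum where
  n := φ.n
  k := φ.k
  α := -φ.α
  β := -φ.β

/-- The numerator of `a` is odd in `(α, β)` and the denominator is even. -/
theorem reflect_a (φ : ExpSum) (j : Fin φ.reflect.n) : φ.reflect.a j = -φ.a j := by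
  simp only [a, Pi.neg_apply]
  rw [← neg_div]
  congr 1 <;> ring

theorem reflect_intMul (φ ψ : ExpSum) (x y t : ℝ) :
    φ.reflect.intMul ψ.reflect x y t = -φ.intMul ψ (-x) (-y) (-t) := by
  simp only [intMul, ← Finset.sum_neg_distrib]
  refine Finset.sum_congr rfl fun i _ => Finset.sum_congr rfl fun j _ => ?_
  rw [reflect_a, reflect_a, ← neg_add, div_neg]
  congr 4
  simp only [Pi.neg_apply]
  ring

theorem reflect_gram (φ ψ : ExpSum) (x y t : ℝ) :
    φ.reflect.gram ψ.reflect x y t = φ.gram ψ (-x) (-y) (-t) := by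
  simp only [gram, Pi.sub_apply, Pi.mul_apply, Pi.pow_apply, reflect_intMul]
  ring

theorem gram_pos {φ ψ : ExpSum} (hφn : 0 < φ.n) (hψn : 0 < ψ.n) (hkφ : ∀ i, 0 < φ.k i)
    (hkψ : ∀ j, 0 < ψ.k j) (ha : ∀ i j, φ.a i < ψ.a j)
    (hsign : (∀ i, 0 < φ.a i) ∨ ∀ j, ψ.a j < 0) (x y t : ℝ) : 0 < φ.gram ψ x y t := by
  rcases hsign with h | h
  · exact gram_pos_of_pos hφn hψn hkφ hkψ ha h (fun j => (h ⟨0, hφn⟩).trans (ha _ j)) x y t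
  · have hψ : ∀ j, 0 < ψ.reflect.a j := fun j => by
      rw [reflect_a]
      exact neg_pos.mpr (h j)
    -- Reflection reverses the order of the exponents, so `φ` and `ψ` exchange roles; the symmetry
    -- of the determinant undoes this.
    have hlt : ∀ j i, ψ.reflect.a j < φ.reflect.a i := fun j i => by
      rw [reflect_a, reflect_a]
      exact neg_lt_neg (ha i j)
    have hp := gram_pos_of_pos (φ := ψ.reflect) (ψ := φ.reflect) hψn hφn hkψ hkφ hlt hψ
      (fun i => (hψ ⟨0, hψn⟩).trans (hlt _ i)) (-x) (-y) (-t)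
    rwa [gram_comm, reflect_gram, neg_neg, neg_neg, neg_neg] at hp

/-! ### The two-fold transformation of the seed -/

/-- The entries `Vᵢᵀ M⁻¹ Vⱼ`, where `Vᵢ` is the `i`-th `x`-derivative of `(φ, ψ)` and `M` is the
matrix of the primitives of `φ²`, `φψ`, `ψ²`. -/
def potential (φ ψ : ExpSum) (i j : ℕ) : Field :=
  (ψ.intMul ψ * (φ.moment i * φ.moment j) -
    φ.intMul ψ * (φ.moment i * ψ.moment j + ψ.moment i * φ.moment j) +
    φ.intMul φ * (ψ.moment i * ψ.moment j)) * (φ.gram ψ)⁻¹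

theorem gram_mul_inv {φ ψ : ExpSum} (hD : ∀ x y t, φ.gram ψ x y t ≠ 0) :
    φ.gram ψ * (φ.gram ψ)⁻¹ = 1 := by
  funext x y t
  exact mul_inv_cancel₀ (hD x y t)

/-- Jacobi's formula: `(log |det M|)ₓ = tr (M⁻¹ V₀V₀ᵀ) = V₀ᵀ M⁻¹ V₀`. -/
theorem dx_logAbs_gram {φ ψ : ExpSum} (h11 : ∀ i j, φ.a i + φ.a j ≠ 0)
    (h12 : ∀ i j, φ.a i + ψ.a j ≠ 0) (h22 : ∀ i j, ψ.a i + ψ.a j ≠ 0)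
    (hD : ∀ x y t, φ.gram ψ x y t ≠ 0) :
    dx (logAbs (φ.gram ψ)) = φ.potential ψ 0 0 := by
  rw [dx_logAbs (φ.smooth_gram ψ) hD, potential]
  congr 1
  simp (maxDischargeDepth := 20) only [gram, dx_sub, dx_mul, dx_pow, smooth_intMul, Smooth.mul,
    Smooth.pow, dx_intMul h11, dx_intMul h12, dx_intMul h22]
  push_cast
  ring

/-- The product rule for `Vᵢᵀ M⁻¹ Vⱼ`, with `M⁻¹` written as adjugate over determinant. The
quadratic terms come from `-M⁻¹ M' M⁻¹`. -/
theorem isPotentialFamily {φ ψ : ExpSum} (h11 : ∀ i j, φ.a i + φ.a j ≠ 0)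
    (h12 : ∀ i j, φ.a i + ψ.a j ≠ 0) (h22 : ∀ i j, ψ.a i + ψ.a j ≠ 0)
    (hαφ : ∀ j, φ.α j = φ.a j ^ 3 + 3 * φ.a j) (hαψ : ∀ j, ψ.α j = ψ.a j ^ 3 + 3 * ψ.a j)
    (hβφ : ∀ j, φ.β j = φ.a j ^ 5 + 5 * φ.a j ^ 3 + 15 * φ.a j)
    (hβψ : ∀ j, ψ.β j = ψ.a j ^ 5 + 5 * ψ.a j ^ 3 + 15 * ψ.a j)
    (hD : ∀ x y t, φ.gram ψ x y t ≠ 0) : IsPotentialFamily (φ.potential ψ) where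
  smooth i j := by
    simp (maxDischargeDepth := 20) only [potential, Smooth.add, Smooth.sub, Smooth.mul,
      smooth_intMul, smooth_moment, Smooth.inv (φ.smooth_gram ψ) hD]
  symm i j := by
    rw [potential, potential]
    ring
  dx_eq i j := by
    have hE := gram_mul_inv hD
    have hg := φ.smooth_gram ψ
    have hi := hg.inv hD
    have hd := dx_inv hg hD
    simp (maxDischargeDepth := 20) only [potential, dx_add, dx_sub, dx_mul, hd, hi, Smooth.add,
      Smooth.sub, Smooth.mul, smooth_intMul, smooth_moment, dx_moment, dx_intMul h11, dx_intMul h12,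
      dx_intMul h22]
    generalize (φ.gram ψ)⁻¹ = E at *
    simp (maxDischargeDepth := 20) only [gram, dx_sub, dx_mul, dx_pow, smooth_intMul, Smooth.mul,
      Smooth.pow, dx_intMul h11, dx_intMul h12, dx_intMul h22, Nat.cast_ofNat, Nat.reduceSub,
      pow_one] at hE ⊢
    -- With the inverse determinant treated as an indeterminate `E`, differentiating the adjugate
    -- yields terms with one factor `E`, while the products `S i 0 * S 0 j` carry `E²`. Multiplying
    -- the former by `det M * E = 1` matches the two; the coefficient is exactly that derivative
    -- term. The `y` and `t` cases below work alike.
    linear_combination -(((ψ.moment 0 * ψ.moment 0) * (φ.moment i * φ.moment j) - (φ.moment 0 *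
      ψ.moment 0) * (φ.moment i * ψ.moment j + ψ.moment i * φ.moment j) + (φ.moment 0 * φ.moment
      0) * (ψ.moment i * ψ.moment j)) * E) * hE
  dy_eq i j := by
    have hE := gram_mul_inv hD
    have hg := φ.smooth_gram ψ
    have hi := hg.inv hD
    have hd := dy_inv hg hD
    simp (maxDischargeDepth := 20) only [potential, dy_add, dy_sub, dy_mul, hd, hi, Smooth.add,
      Smooth.sub, Smooth.mul, smooth_intMul, smooth_moment, dy_moment hαφ, dy_moment hαψ,
      dy_intMul h11 hαφ hαφ, dy_intMul h12 hαφ hαψ, dy_intMul h22 hαψ hαψ]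
    generalize (φ.gram ψ)⁻¹ = E at *
    simp (maxDischargeDepth := 20) only [gram, dy_sub, dy_mul, dy_pow, smooth_intMul, Smooth.mul,
      Smooth.pow, dy_intMul h11 hαφ hαφ, dy_intMul h12 hαφ hαψ, dy_intMul h22 hαψ hαψ,
      Nat.cast_ofNat, Nat.reduceSub, pow_one] at hE ⊢
    linear_combination -(((ψ.moment 0 * ψ.moment 2 + ψ.moment 2 * ψ.moment 0 - ψ.moment 1 *
      ψ.moment 1 + 3 * ψ.moment 0 * ψ.moment 0) * (φ.moment i * φ.moment j) - (φ.moment 0 *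
      ψ.moment 2 + φ.moment 2 * ψ.moment 0 - φ.moment 1 * ψ.moment 1 + 3 * φ.moment 0 * ψ.moment
      0) * (φ.moment i * ψ.moment j + ψ.moment i * φ.moment j) + (φ.moment 0 * φ.moment 2 +
      φ.moment 2 * φ.moment 0 - φ.moment 1 * φ.moment 1 + 3 * φ.moment 0 * φ.moment 0) *
      (ψ.moment i * ψ.moment j)) * E) * hE
  dt_eq i j := by
    have hE := gram_mul_inv hD
    have hg := φ.smooth_gram ψ
    have hi := hg.inv hD
    have hd := dt_inv hg hD
    simp (maxDischargeDepth := 20) only [potential, dt_add, dt_sub, dt_mul, hd, hi, Smooth.add,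
      Smooth.sub, Smooth.mul, smooth_intMul, smooth_moment, dt_moment hβφ, dt_moment hβψ,
      dt_intMul h11 hβφ hβφ, dt_intMul h12 hβφ hβψ, dt_intMul h22 hβψ hβψ]
    generalize (φ.gram ψ)⁻¹ = E at *
    simp (maxDischargeDepth := 20) only [gram, dt_sub, dt_mul, dt_pow, smooth_intMul, Smooth.mul,
      Smooth.pow, dt_intMul h11 hβφ hβφ, dt_intMul h12 hβφ hβψ, dt_intMul h22 hβψ hβψ,
      Nat.cast_ofNat, Nat.reduceSub, pow_one] at hE ⊢
    linear_combination -(((ψ.moment 0 * ψ.moment 4 + ψ.moment 4 * ψ.moment 0 - ψ.moment 1 *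
      ψ.moment 3 - ψ.moment 3 * ψ.moment 1 + ψ.moment 2 * ψ.moment 2 + 5 * ψ.moment 0 * ψ.moment
      2 + 5 * ψ.moment 2 * ψ.moment 0 - 5 * ψ.moment 1 * ψ.moment 1 + 15 * ψ.moment 0 * ψ.moment
      0) * (φ.moment i * φ.moment j) - (φ.moment 0 * ψ.moment 4 + φ.moment 4 * ψ.moment 0 -
      φ.moment 1 * ψ.moment 3 - φ.moment 3 * ψ.moment 1 + φ.moment 2 * ψ.moment 2 + 5 * φ.moment
      0 * ψ.moment 2 + 5 * φ.moment 2 * ψ.moment 0 - 5 * φ.moment 1 * ψ.moment 1 + 15 * φ.moment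
      0 * ψ.moment 0) * (φ.moment i * ψ.moment j + ψ.moment i * φ.moment j) + (φ.moment 0 *
      φ.moment 4 + φ.moment 4 * φ.moment 0 - φ.moment 1 * φ.moment 3 - φ.moment 3 * φ.moment 1 +
      φ.moment 2 * φ.moment 2 + 5 * φ.moment 0 * φ.moment 2 + 5 * φ.moment 2 * φ.moment 0 - 5 *
      φ.moment 1 * φ.moment 1 + 15 * φ.moment 0 * φ.moment 0) * (ψ.moment i * ψ.moment j)) * E)
      * hE

end ExpSum

end CKP

end

theorem theorem2 (φ₁ φ₂ : CKP.ExpSum)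
    (hn₁ : 0 < φ₁.n) (hn₂ : 0 < φ₂.n)
    (hr₁ : φ₁.Relation) (hr₂ : φ₂.Relation)
    (hk₁ : ∀ i, 0 < φ₁.k i) (hk₂ : ∀ j, 0 < φ₂.k j)
    (ha : ∀ i j, φ₁.a i < φ₂.a j)
    (hsign : (∀ i, 0 < φ₁.a i) ∨ (∀ j, φ₂.a j < 0)) :
    CKP.IsSeedEigenfunction φ₁.eval ∧ CKP.IsSeedEigenfunction φ₂.eval ∧
    (∀ x y t, CKP.IW22 φ₂ φ₁ φ₁ φ₂ x y t < 0) ∧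
    CKP.IsKKSolution
      (fun x y t => 1 + (CKP.dx^[2] (CKP.logAbs (CKP.IW22 φ₂ φ₁ φ₁ φ₂))) x y t)
      (fun x y t => 6 + CKP.dy (CKP.dx (CKP.logAbs (CKP.IW22 φ₂ φ₁ φ₁ φ₂))) x y t) := by
  -- Since the exponents are ordered and both sums are nonempty, a sign given for one family passes
  -- to the other.
  have ha₁ : ∀ i, φ₁.a i ≠ 0 := fun i => hsign.elim (fun h => (h i).ne')
    fun h => ((ha i ⟨0, hn₂⟩).trans (h _)).ne
  have ha₂ : ∀ j, φ₂.a j ≠ 0 := fun j => hsign.elim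
    (fun h => ((h ⟨0, hn₁⟩).trans (ha _ j)).ne') fun h => (h j).ne
  have hα₁ := fun i => hr₁.alpha_eq (ha₁ i)
  have hα₂ := fun j => hr₂.alpha_eq (ha₂ j)
  have hβ₁ := fun i => hr₁.beta_eq (ha₁ i)
  have hβ₂ := fun j => hr₂.beta_eq (ha₂ j)
  have hgram := CKP.ExpSum.gram_pos hn₁ hn₂ hk₁ hk₂ ha hsign
  have hne := fun x y t => (hgram x y t).ne'
  have hsame : ((∀ i, 0 < φ₁.a i) ∧ ∀ j, 0 < φ₂.a j) ∨
      ((∀ i, φ₁.a i < 0) ∧ ∀ j, φ₂.a j < 0) :=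
    hsign.imp (fun h => ⟨h, fun j => (h ⟨0, hn₁⟩).trans (ha _ j)⟩)
      fun h => ⟨fun i => (ha i ⟨0, hn₂⟩).trans (h _), h⟩
  have h11 : ∀ i j, φ₁.a i + φ₁.a j ≠ 0 := fun i j =>
    hsame.elim (fun h => (add_pos (h.1 i) (h.1 j)).ne') fun h => (add_neg (h.1 i) (h.1 j)).ne
  have h12 : ∀ i j, φ₁.a i + φ₂.a j ≠ 0 := fun i j =>
    hsame.elim (fun h => (add_pos (h.1 i) (h.2 j)).ne') fun h => (add_neg (h.1 i) (h.2 j)).ne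
  have h22 : ∀ i j, φ₂.a i + φ₂.a j ≠ 0 := fun i j =>
    hsame.elim (fun h => (add_pos (h.2 i) (h.2 j)).ne') fun h => (add_neg (h.2 i) (h.2 j)).ne
  refine ⟨CKP.ExpSum.isSeedEigenfunction hα₁ hβ₁, CKP.ExpSum.isSeedEigenfunction hα₂ hβ₂,
    fun x y t => ?_, ?_⟩
  · rw [CKP.ExpSum.IW22_eq_neg_gram]
    exact neg_neg_of_pos (hgram x y t)
  · have hS := CKP.ExpSum.isPotentialFamily h11 h12 h22 hα₁ hα₂ hβ₁ hβ₂ hne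
    rw [CKP.ExpSum.IW22_eq_neg_gram, CKP.logAbs_neg, Function.iterate_succ_apply,
      Function.iterate_one, CKP.ExpSum.dx_logAbs_gram h11 h12 h22 hne]
    have h := hS.isKKSolution
    -- This restores `jet S 2` to the `x`-derivative of `S 0 0`, which is the first `x`-derivative
    -- of the logarithm.
    rw [← hS.dx_jet_one] at h
    exact h
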